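/- Let $K$ be a field and let $A$ be a $K$-algebra which is an integral domain. A degree-like function on $A$ is a map $\delta : A\setminus\{0\}\to\mathbb Z\cup\{-\infty\}$, extended by $\delta(0)=-\infty$, such that $\delta(c)=0$ for all $c\in K\setminus\{0\}$; $\delta(f+g)\le\max\{\delta(f),\delta(g)\}$ for all $f,g \in A$, where strict inequality implies $\delta(f)=\delta(g)$; and $\delta(fg)\le\delta(f)+\delta(g)$ for all $f,g \in A$. It is a semidegree if $\delta(fg)=\delta(f)+\delta(g)$ for all nonzero $f,g$. It is a subdegree if $\delta=\max_{1\le i\le N}\delta_i$ on $A\setminus\{0\}$ for finitely many semidegrees $\delta_1,\dots,\delta_N$; this presentation is minimal if for every $i$ there is a nonzero $f\in A$ with $\delta_i(f)>\delta_j(f)$ for all $j\ne i$. For a degree-like function $\delta$ put $F_d=\{f\in A:\delta(f)\le d\}$ for $d\in\mathbb Z$, let $A^\delta=\bigoplus_{d\ge0}F_d\cong\sum_{d\ge 0}F_dt^d\subseteq A[t]$, graded by the degree in $t$, and let $\bar X^\delta=\operatorname{Proj}A^\delta$. The space $X=\operatorname{Spec}A$ is regarded as a subset of $\bar X^\delta$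 via $\mathfrak p\mapsto\bigoplus_{d\ge0}(\mathfrak p\cap F_d)$. Let $\delta$ be a subdegree on $A$ which is non-negative, that is, $\delta(f)\ge0$ for all $f\neq0$, and let $\delta=\max_{1\le i\le N}\delta_i$ be a minimal presentation of $\delta$ by semidegrees. Then the number of irreducible components of $X_\infty:=\bar X^\delta\setminus X$, with the subspace topology of the Zariski topology, is $N$ if none of the $\delta_i$ is the zero degree-like function ($f\mapsto0$ for all $f\ne0$), and is $N-1$ if one of the $\delta_i$ is the zero degree-like function. -/

import Mathlib

open Polynomial

/-- A degree-like function on a `K`-algebra `A`: a map `δ : A ∖ {0} → ℤ ∪ {-∞}`, extended to all of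
`A` by the convention `δ 0 = -∞` (here `-∞` is `⊥`, and `⊥ + x = ⊥`). -/
structure DegreeLike (K A : Type*) [Field K] [CommRing A] [Algebra K A] where
  toFun : A → WithBot ℤ
  map_zero' : toFun 0 = ⊥
  map_const' : ∀ c : K, c ≠ 0 → toFun (algebraMap K A c) = 0
  map_add_le' : ∀ f g : A, toFun (f + g) ≤ max (toFun f) (toFun g)
  eq_of_map_add_lt' : ∀ f g : A, toFun (f + g) < max (toFun f) (toFun g) → toFun f = toFun g
  map_mul_le' : ∀ f g : A, toFun (f * g) ≤ toFun f + toFun g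

namespace DegreeLike

variable {K A : Type*} [Field K] [CommRing A] [Algebra K A]

instance : CoeFun (DegreeLike K A) (fun _ => A → WithBot ℤ) := ⟨toFun⟩

/-- A semidegree: a degree-like function which is multiplicative on nonzero elements. -/
def IsSemidegree (δ : DegreeLike K A) : Prop :=
  ∀ f g : A, f ≠ 0 → g ≠ 0 → δ (f * g) = δ f + δ g

/-- `δ = max (δ₁, …, δ_N)` with all `δ_i` semidegrees; `δ` is a subdegree iff it has such a
presentation (the supremum over an empty family is `-∞`, so `N = 0` is impossible as `δ 1 = 0`). -/
structure IsPresentation (δ : DegreeLike K A) {N : ℕ} (δs : Fin N → DegreeLike K A) : Prop where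
  isSemidegree : ∀ i, (δs i).IsSemidegree
  eq_max : ∀ f : A, f ≠ 0 → δ f = Finset.univ.sup (fun i => δs i f)

/-- A presentation in which no `δ_i` is redundant: each `δ_i` is, at some element, strictly
bigger than all the others. -/
structure IsMinimalPresentation (δ : DegreeLike K A) {N : ℕ} (δs : Fin N → DegreeLike K A) : Prop
    extends δ.IsPresentation δs where
  not_redundant : ∀ i, ∃ f : A, f ≠ 0 ∧ ∀ j, j ≠ i → δs j f < δs i f

/-- `δ` is non-negative. -/
def IsNonneg (δ : DegreeLike K A) : Prop := ∀ f : A, f ≠ 0 → 0 ≤ δ f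

/-- `δ` is the zero degree-like function, `f ↦ 0` for all nonzero `f`. -/
def IsZero (δ : DegreeLike K A) : Prop := ∀ f : A, f ≠ 0 → δ f = 0

theorem map_const_le (δ : DegreeLike K A) (c : K) : δ (algebraMap K A c) ≤ 0 := by
  by_cases hc : c = 0
  · subst hc
    rw [map_zero, δ.map_zero']
    exact bot_le
  · exact (δ.map_const' c hc).le

theorem map_one (δ : DegreeLike K A) : δ 1 = 0 := by
  simpa using δ.map_const' 1 one_ne_zero

/-- The filtration `F_d = {f : δ f ≤ d}` of `A` by `K`-subspaces, `d ∈ ℤ`. -/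
def filtration (δ : DegreeLike K A) (d : ℤ) : Submodule K A where
  carrier := {f | δ f ≤ (d : WithBot ℤ)}
  add_mem' {f g} hf hg := (δ.map_add_le' f g).trans (max_le hf hg)
  zero_mem' := by
    change δ 0 ≤ _
    rw [δ.map_zero']
    exact bot_le
  smul_mem' c f hf := by
    change δ (c • f) ≤ _
    rw [Algebra.smul_def]
    calc δ (algebraMap K A c * f) ≤ δ (algebraMap K A c) + δ f := δ.map_mul_le' _ _
      _ ≤ 0 + (d : WithBot ℤ) := add_le_add (δ.map_const_le c) hf
      _ = d := zero_add _

theorem mem_filtration {δ : DegreeLike K A} {d : ℤ} {f : A} :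
    f ∈ δ.filtration d ↔ δ f ≤ (d : WithBot ℤ) := Iff.rfl

theorem mul_mem_filtration {δ : DegreeLike K A} {d e : ℤ} {f g : A}
    (hf : f ∈ δ.filtration d) (hg : g ∈ δ.filtration e) : f * g ∈ δ.filtration (d + e) := by
  rw [mem_filtration] at *
  refine (δ.map_mul_le' f g).trans ((add_le_add hf hg).trans ?_)
  exact_mod_cast le_rfl

/-- The ring `A^δ = ⨁_{d ≥ 0} F_d`, realized as `∑_{d ≥ 0} F_d t^d ⊆ A[t]`;
the copy `(f)_d` of `f ∈ F_d` in degree `d` is the monomial `f t^d`. -/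
def gradedRing (δ : DegreeLike K A) : Subalgebra K A[X] where
  carrier := {p | ∀ d : ℕ, p.coeff d ∈ δ.filtration d}
  add_mem' {p q} hp hq d := by
    rw [coeff_add]
    exact add_mem (hp d) (hq d)
  mul_mem' {p q} hp hq d := by
    rw [coeff_mul]
    refine sum_mem fun x hx => ?_
    rw [Finset.HasAntidiagonal.mem_antidiagonal] at hx
    rw [← hx, Nat.cast_add]
    exact mul_mem_filtration (hp _) (hq _)
  algebraMap_mem' c d := by
    rw [Polynomial.algebraMap_apply, coeff_C]
    split_ifs with h
    · subst h
      exact δ.map_const_le c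
    · exact zero_mem _

theorem mem_gradedRing {δ : DegreeLike K A} {p : A[X]} :
    p ∈ δ.gradedRing ↔ ∀ d : ℕ, p.coeff d ∈ δ.filtration d := Iff.rfl

theorem monomial_mem_gradedRing {δ : DegreeLike K A} {d : ℕ} {f : A}
    (hf : f ∈ δ.filtration d) : monomial d f ∈ δ.gradedRing := by
  intro e
  rw [coeff_monomial]
  split_ifs with h
  · rwa [← h]
  · exact zero_mem _

/-- The degree `d` part `{(f)_d : f ∈ F_d} = F_d t^d` of `A^δ`. -/
def gradedPiece (δ : DegreeLike K A) (d : ℕ) : Submodule K δ.gradedRing where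
  carrier := {p | ∀ e : ℕ, e ≠ d → (p : A[X]).coeff e = 0}
  add_mem' {p q} hp hq e he := by
    simp [hp e he, hq e he]
  zero_mem' e _ := by simp
  smul_mem' c p hp e he := by
    simp [hp e he]

theorem mem_gradedPiece {δ : DegreeLike K A} {d : ℕ} {p : δ.gradedRing} :
    p ∈ δ.gradedPiece d ↔ ∀ e : ℕ, e ≠ d → (p : A[X]).coeff e = 0 := Iff.rfl

/-- The homogeneous component `(p_d)_d` of an element `p = ∑_d (p_d)_d` of `A^δ`. -/
noncomputable def component (δ : DegreeLike K A) (d : ℕ) (p : δ.gradedRing) : δ.gradedPiece d :=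
  ⟨⟨monomial d ((p : A[X]).coeff d), monomial_mem_gradedRing (p.2 d)⟩, fun e he => by
    rw [coeff_monomial, if_neg (Ne.symm he)]⟩

theorem coe_component (δ : DegreeLike K A) (d : ℕ) (p : δ.gradedRing) :
    ((δ.component d p : δ.gradedRing) : A[X]) = monomial d ((p : A[X]).coeff d) := rfl

theorem coeff_coe_directSum (δ : DegreeLike K A) (x : DirectSum ℕ fun d => δ.gradedPiece d)
    (d : ℕ) :
    ((DirectSum.coeAddMonoidHom δ.gradedPiece x : δ.gradedRing) : A[X]).coeff d =
      ((x d : δ.gradedRing) : A[X]).coeff d := by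
  induction x using DirectSum.induction_on with
  | zero => simp
  | of i y =>
    rw [DirectSum.coeAddMonoidHom_of]
    by_cases h : i = d
    · subst h
      rw [DirectSum.of_eq_same]
    · rw [DirectSum.of_eq_of_ne _ _ _ (Ne.symm h), y.2 d (Ne.symm h)]
      simp
  | add x y hx hy => simp [hx, hy]

noncomputable instance (δ : DegreeLike K A) : GradedAlgebra δ.gradedPiece where
  one_mem e he := by
    change (1 : A[X]).coeff e = 0
    rw [coeff_one, if_neg he]
  mul_mem i j p q hp hq e he := by
    change ((p : A[X]) * (q : A[X])).coeff e = 0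
    rw [coeff_mul]
    refine Finset.sum_eq_zero fun x hx => ?_
    rw [Finset.HasAntidiagonal.mem_antidiagonal] at hx
    by_cases h : x.1 = i
    · have h2 : x.2 ≠ j := by omega
      rw [hq _ h2, mul_zero]
    · rw [hp _ h, zero_mul]
  decompose' p := DirectSum.mk _ (p : A[X]).support fun d => δ.component d p
  left_inv p := by
    refine Subtype.ext (Polynomial.ext fun d => ?_)
    rw [coeff_coe_directSum]
    by_cases h : d ∈ (p : A[X]).support
    · rw [DirectSum.mk_apply_of_mem h, coe_component, coeff_monomial, if_pos rfl]
    · rw [DirectSum.mk_apply_of_notMem h, notMem_support_iff.mp h]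
      simp
  right_inv x := by
    refine DFinsupp.ext fun d => Subtype.ext (Subtype.ext (Polynomial.ext fun e => ?_))
    by_cases h : d ∈ ((DirectSum.coeAddMonoidHom δ.gradedPiece x : δ.gradedRing) : A[X]).support
    · rw [DirectSum.mk_apply_of_mem h, coe_component, coeff_coe_directSum, coeff_monomial]
      split_ifs with he
      · have hde : d = e := he
        subst hde
        rfl
      · exact ((x d).2 e (Ne.symm he)).symm
    · rw [DirectSum.mk_apply_of_notMem h]
      rw [notMem_support_iff, coeff_coe_directSum] at h
      by_cases he : e = d
      · subst he
        simp [h]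
      · rw [(x d).2 e he]
        simp

theorem coe_decompose (δ : DegreeLike K A) (p : δ.gradedRing) (d : ℕ) :
    ((DirectSum.decompose δ.gradedPiece p d : δ.gradedRing) : A[X]) =
      monomial d ((p : A[X]).coeff d) := by
  change ((DirectSum.mk (fun d => δ.gradedPiece d) (p : A[X]).support
    (fun d => δ.component d p) d : δ.gradedRing) : A[X]) = _
  by_cases h : d ∈ (p : A[X]).support
  · rw [DirectSum.mk_apply_of_mem h, coe_component]
  · rw [DirectSum.mk_apply_of_notMem h, notMem_support_iff.mp h]
    simp

/-- The completion `X̄^δ = Proj A^δ` of `X = Spec A` (its underlying topological space, with the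
Zariski topology). -/
abbrev Completion (δ : DegreeLike K A) := ProjectiveSpectrum δ.gradedPiece

/-- The homogeneous ideal `⨁_{d ≥ 0} (𝔭 ∩ F_d)` of `A^δ`. -/
noncomputable def homogenization (δ : DegreeLike K A) (P : Ideal A) :
    HomogeneousIdeal δ.gradedPiece where
  toSubmodule := (P.map (C : A →+* A[X])).comap δ.gradedRing.val.toRingHom
  is_homogeneous' d p hp := by
    rw [Ideal.mem_comap] at *
    change ((DirectSum.decompose δ.gradedPiece p d : δ.gradedRing) : A[X]) ∈ _
    change (p : A[X]) ∈ _ at hp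
    rw [Ideal.mem_map_C_iff] at *
    intro e
    rw [coe_decompose, coeff_monomial]
    split_ifs
    · exact hp d
    · exact zero_mem _

theorem mem_homogenization {δ : DegreeLike K A} {P : Ideal A} {p : δ.gradedRing} :
    p ∈ δ.homogenization P ↔ ∀ d : ℕ, (p : A[X]).coeff d ∈ P :=
  Ideal.mem_map_C_iff

/-- The embedding `X = Spec A → X̄^δ`, `𝔭 ↦ ⨁_{d ≥ 0} (𝔭 ∩ F_d)`. -/
noncomputable def embedding (δ : DegreeLike K A) (P : PrimeSpectrum A) : δ.Completion where
  asHomogeneousIdeal := δ.homogenization P.asIdeal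
  isPrime := by
    have : (P.asIdeal.map (C : A →+* A[X])).IsPrime :=
      (Ideal.isPrime_map_C_iff_isPrime _).mpr P.isPrime
    exact Ideal.comap_isPrime δ.gradedRing.val.toRingHom (P.asIdeal.map (C : A →+* A[X]))
  not_irrelevant_le h := by
    have ht : (1 : A) ∈ δ.filtration (1 : ℕ) := by
      rw [mem_filtration, δ.map_one]
      exact_mod_cast zero_le_one
    have hX : (⟨monomial 1 1, monomial_mem_gradedRing ht⟩ : δ.gradedRing) ∈
        HomogeneousIdeal.irrelevant δ.gradedPiece := by
      rw [HomogeneousIdeal.mem_irrelevant_iff, GradedRing.proj_apply]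
      refine Subtype.ext ?_
      rw [coe_decompose]
      simp [coeff_monomial]
    have h1 := mem_homogenization.mp (h hX) 1
    rw [coeff_monomial, if_pos rfl] at h1
    exact P.isPrime.ne_top ((Ideal.eq_top_iff_one _).mpr h1)

/-- `X_∞ = X̄^δ ∖ X`, the part at infinity of the completion. -/
def atInfinity (δ : DegreeLike K A) : Set δ.Completion := (Set.range δ.embedding)ᶜ

end DegreeLike

/-!
Write `(f)_d` for the monomial `f t ^ d` of `A^δ`, where `f ∈ F_d`, and `t = (1)_1`.

The open part `X` of the completion is the basic open set `t ≠ 0`: a homogeneous prime `Q` with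
`t ∉ Q` is recovered from the prime `{f | (f)_d ∈ Q for some d}` of `A`
(`DegreeLike.range_embedding`). So `X_∞` is the closed set `t = 0`.

For a semidegree `ε ≤ δ` the elements `∑ (f_d)_d` with `ε f_d < d` for all `d` form a homogeneous
ideal `P_ε` (`DegreeLike.initialIdeal`), which is prime because `ε` is multiplicative. If
`δ = max δ_i` is non-negative, then `⋂ P_{δ_i} = (t)`, so every homogeneous prime containing `t`
contains some `P_{δ_i}` (`DegreeLike.exists_initialIdeal_le`), and minimality of the presentation
implies that no `P_{δ_i}` contains another one.

It remains to see which `P_{δ_i}` are points of `Proj`, i.e. do not contain the irrelevant ideal.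
If `δ_i = 0` then `P_{δ_i}` clearly contains it. Otherwise some `h` satisfies `δ h = δ_i h > 0`
(`DegreeLike.exists_pos_of_not_isZero`): if `g` is an element at which `δ_i` dominates strictly and
`δ_i g = 0`, then all other `δ_j g` are negative, hence `δ_i` is the maximum at `f g ^ k` for
large `k`, where its value is that of `δ_i f`; as `δ ≥ 0` this forces `δ_i f ≥ 0` for all `f ≠ 0`,
and any `f` with `δ_i f ≠ 0` gives the required `h = f g ^ k`.

Hence the irreducible components of `X_∞` are the closures of the points `P_{δ_i}` with `δ_i ≠ 0`,
and at most one of the `δ_i` is zero.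
-/

/-! ### Irreducible components as closures of generic points -/

/-- If finitely many points, none of which specializes to another, are such that every point is a
specialization of one of them, then the irreducible components are exactly their closures. -/
theorem encard_irreducibleComponents_of_specializes {X ι : Type*} [TopologicalSpace X] [Finite ι]
    (x : ι → X) (hcover : ∀ y, ∃ i, x i ⤳ y) (hinj : ∀ i j, x i ⤳ x j → i = j) :
    (irreducibleComponents X).encard = ENat.card ι := by
  have hirr : ∀ i, IsIrreducible (closure {x i}) := fun i => isIrreducible_singleton.closure
  have hle : ∀ S : Set X, IsIrreducible S → ∃ i, S ⊆ closure {x i} := by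
    intro S hS
    have hfin := Set.finite_range fun i => closure {x i}
    obtain ⟨z, hz, hSz⟩ := isIrreducible_iff_sUnion_isClosed.mp hS hfin.toFinset
      (by
        intro z hz
        rw [Set.Finite.mem_toFinset] at hz
        obtain ⟨i, rfl⟩ := hz
        exact isClosed_closure)
      (by
        intro y _
        obtain ⟨i, hi⟩ := hcover y
        exact ⟨_, by simp, hi.mem_closure⟩)
    rw [Set.Finite.mem_toFinset] at hz
    obtain ⟨i, rfl⟩ := hz
    exact ⟨i, hSz⟩
  have hsub : ∀ i j, closure {x i} ⊆ closure {x j} → j = i := fun i j h =>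
    hinj _ _ (specializes_iff_mem_closure.mpr (h (subset_closure rfl)))
  have hrange : irreducibleComponents X = Set.range fun i => closure {x i} := by
    ext S
    constructor
    · intro hS
      obtain ⟨i, hi⟩ := hle S hS.1
      exact ⟨i, (hS.2 (hirr i) hi).antisymm hi⟩
    · rintro ⟨i, rfl⟩
      refine ⟨hirr i, fun T hT hiT => ?_⟩
      obtain ⟨j, hj⟩ := hle T hT
      have hji := hsub i j (Set.Subset.trans hiT hj)
      subst hji
      exact hj
  rw [hrange, ← Set.image_univ, Function.Injective.encard_image, Set.encard_univ]
  intro i j hij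
  exact hsub i j (le_of_eq hij) |>.symm

namespace DegreeLike

variable {K A : Type*} [Field K] [CommRing A] [Algebra K A]

/-! ### Monomials and homogeneous ideals of the graded ring -/

/-- The monomial `(f)_d = f t ^ d`, the copy of `f ∈ F_d` in degree `d` of `A^δ`. -/
noncomputable def single (δ : DegreeLike K A) (d : ℕ) (f : A) (hf : f ∈ δ.filtration d) :
    δ.gradedRing :=
  ⟨monomial d f, monomial_mem_gradedRing hf⟩

theorem filtration_mono (δ : DegreeLike K A) {d e : ℤ} (h : d ≤ e) {f : A}
    (hf : f ∈ δ.filtration d) : f ∈ δ.filtration e :=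
  le_trans (mem_filtration.mp hf) (by exact_mod_cast h)

theorem one_mem_filtration (δ : DegreeLike K A) (d : ℕ) : (1 : A) ∈ δ.filtration d := by
  rw [mem_filtration, δ.map_one]
  exact_mod_cast Nat.zero_le d

theorem exists_mem_filtration (δ : DegreeLike K A) (f : A) : ∃ d : ℕ, f ∈ δ.filtration d := by
  cases h : δ f with
  | bot => exact ⟨0, by rw [mem_filtration, h]; exact bot_le⟩
  | coe n => exact ⟨n.toNat, by rw [mem_filtration, h]; exact_mod_cast Int.self_le_toNat n⟩

/-- The element `t = (1)_1` of `A^δ`. -/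
noncomputable def parameter (δ : DegreeLike K A) : δ.gradedRing :=
  δ.single 1 1 (δ.one_mem_filtration 1)

theorem single_mul_single (δ : DegreeLike K A) {d e : ℕ} {f g : A} (hf : f ∈ δ.filtration d)
    (hg : g ∈ δ.filtration e) :
    δ.single d f hf * δ.single e g hg =
      δ.single (d + e) (f * g) (by rw [Nat.cast_add]; exact mul_mem_filtration hf hg) :=
  Subtype.ext (monomial_mul_monomial d e f g)

theorem single_congr (δ : DegreeLike K A) {d e : ℕ} {f g : A} (hf : f ∈ δ.filtration d)
    (hg : g ∈ δ.filtration e) (hde : d = e) (hfg : f = g) : δ.single d f hf = δ.single e g hg := by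
  subst hde hfg
  rfl

theorem single_one_eq_parameter_pow (δ : DegreeLike K A) (d : ℕ) :
    δ.single d 1 (δ.one_mem_filtration d) = δ.parameter ^ d := by
  refine Subtype.ext ?_
  change monomial d (1 : A) = (monomial 1 (1 : A)) ^ d
  rw [monomial_pow, one_pow, one_mul]

theorem exists_eq_single_of_mem_gradedPiece {δ : DegreeLike K A} {d : ℕ} {p : δ.gradedRing}
    (hp : p ∈ δ.gradedPiece d) :
    ∃ (f : A) (hf : f ∈ δ.filtration d), p = δ.single d f hf := by
  refine ⟨_, p.2 d, Subtype.ext (Polynomial.ext fun e => ?_)⟩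
  change _ = (monomial d ((p : A[X]).coeff d)).coeff e
  rw [coeff_monomial]
  split_ifs with h
  · rw [h]
  · exact hp e (Ne.symm h)

theorem single_mem_gradedPiece (δ : DegreeLike K A) {d : ℕ} {f : A} (hf : f ∈ δ.filtration d) :
    δ.single d f hf ∈ δ.gradedPiece d := fun e he => by
  change (monomial d f).coeff e = 0
  rw [coeff_monomial, if_neg (Ne.symm he)]

theorem mem_iff_single_mem {δ : DegreeLike K A} (Q : HomogeneousIdeal δ.gradedPiece)
    (p : δ.gradedRing) : p ∈ Q ↔ ∀ d, δ.single d ((p : A[X]).coeff d) (p.2 d) ∈ Q := by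
  have h := Q.isHomogeneous.mem_iff δ.gradedPiece (x := p)
  refine h.trans (forall_congr' fun d => ?_)
  have : (DirectSum.decompose δ.gradedPiece p d : δ.gradedRing) =
      δ.single d ((p : A[X]).coeff d) (p.2 d) := Subtype.ext (δ.coe_decompose p d)
  rw [this]
  rfl

/-! ### The affine part of the completion -/

section affine

variable {δ : DegreeLike K A}

theorem single_mem_iff_of_parameter_notMem {Q : HomogeneousIdeal δ.gradedPiece}
    (hQ : Q.toIdeal.IsPrime) (ht : δ.parameter ∉ Q) {d e : ℕ} {f : A} (hd : f ∈ δ.filtration d)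
    (he : f ∈ δ.filtration e) : δ.single d f hd ∈ Q ↔ δ.single e f he ∈ Q := by
  have key : ∀ {d e : ℕ} (hd : f ∈ δ.filtration d) (he : f ∈ δ.filtration e),
      δ.single d f hd ∈ Q.toIdeal → δ.single e f he ∈ Q.toIdeal := by
    intro d e hd he h
    have h1 : δ.parameter ^ d * δ.single e f he ∈ Q.toIdeal := by
      have : δ.parameter ^ d * δ.single e f he = δ.parameter ^ e * δ.single d f hd := by
        rw [← single_one_eq_parameter_pow, ← single_one_eq_parameter_pow, single_mul_single,
          single_mul_single]
        exact single_congr _ _ _ (add_comm _ _) rfl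
      rw [this]
      exact Q.toIdeal.mul_mem_left _ h
    exact (hQ.mem_or_mem h1).resolve_left fun h2 => ht (hQ.mem_of_pow_mem _ h2)
  exact ⟨key hd he, key he hd⟩

/-- The ideal `{f | (f)_d ∈ Q for some d}` of `A`, for a homogeneous ideal `Q` of `A^δ`. -/
noncomputable def dehomogenization (Q : HomogeneousIdeal δ.gradedPiece) : Ideal A where
  carrier := {f | ∃ (d : ℕ) (hd : f ∈ δ.filtration d), δ.single d f hd ∈ Q}
  zero_mem' := by
    refine ⟨0, zero_mem _, ?_⟩
    have : δ.single 0 0 (zero_mem _) = 0 := Subtype.ext (map_zero _)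
    rw [this]
    exact zero_mem _
  add_mem' := by
    rintro f g ⟨d, hd, hf⟩ ⟨e, he, hg⟩
    have hd' : f ∈ δ.filtration (d + e : ℕ) := δ.filtration_mono (by push_cast; lia) hd
    have he' : g ∈ δ.filtration (d + e : ℕ) := δ.filtration_mono (by push_cast; lia) he
    refine ⟨d + e, add_mem hd' he', ?_⟩
    have : δ.single (d + e) (f + g) (add_mem hd' he') =
        δ.parameter ^ e * δ.single d f hd + δ.parameter ^ d * δ.single e g he := by
      rw [← single_one_eq_parameter_pow, ← single_one_eq_parameter_pow, single_mul_single,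
        single_mul_single]
      rw [single_congr _ _ hd' (add_comm e d) (one_mul f), single_congr _ _ he' rfl (one_mul g)]
      exact Subtype.ext (map_add _ _ _)
    rw [this]
    exact Q.toIdeal.add_mem (Q.toIdeal.mul_mem_left _ hf) (Q.toIdeal.mul_mem_left _ hg)
  smul_mem' := by
    rintro a f ⟨d, hd, hf⟩
    obtain ⟨e, he⟩ := δ.exists_mem_filtration a
    have h := Q.toIdeal.mul_mem_left (δ.single e a he) hf
    rw [single_mul_single] at h
    exact ⟨_, _, h⟩

theorem single_mem_iff_mem_dehomogenization {Q : HomogeneousIdeal δ.gradedPiece}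
    (hQ : Q.toIdeal.IsPrime) (ht : δ.parameter ∉ Q) {d : ℕ} {f : A} (hd : f ∈ δ.filtration d) :
    δ.single d f hd ∈ Q ↔ f ∈ dehomogenization Q :=
  ⟨fun h => ⟨d, hd, h⟩, fun ⟨_, he, h⟩ => (single_mem_iff_of_parameter_notMem hQ ht he hd).mp h⟩

theorem dehomogenization_isPrime {Q : HomogeneousIdeal δ.gradedPiece}
    (hQ : Q.toIdeal.IsPrime) (ht : δ.parameter ∉ Q) : (dehomogenization Q).IsPrime := by
  refine ⟨fun h => ?_, fun {f g} hfg => ?_⟩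
  · have h1 : (1 : A) ∈ dehomogenization Q := h ▸ Submodule.mem_top
    exact ht ((single_mem_iff_mem_dehomogenization hQ ht (δ.one_mem_filtration 1)).mpr h1)
  · obtain ⟨d, hd⟩ := δ.exists_mem_filtration f
    obtain ⟨e, he⟩ := δ.exists_mem_filtration g
    rw [← single_mem_iff_mem_dehomogenization hQ ht hd,
      ← single_mem_iff_mem_dehomogenization hQ ht he]
    refine hQ.mem_or_mem ?_
    rw [single_mul_single]
    exact (single_mem_iff_mem_dehomogenization hQ ht _).mpr hfg

end affine

/-- The image of `X` in the completion is the basic open set `t ≠ 0`. -/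
theorem range_embedding (δ : DegreeLike K A) :
    Set.range δ.embedding = {Q | δ.parameter ∉ Q.asHomogeneousIdeal} := by
  ext Q
  constructor
  · rintro ⟨P, rfl⟩ h
    have h1 := mem_homogenization.mp h 1
    change (monomial 1 (1 : A)).coeff 1 ∈ _ at h1
    rw [coeff_monomial, if_pos rfl] at h1
    exact P.isPrime.ne_top ((Ideal.eq_top_iff_one _).mpr h1)
  · intro ht
    refine ⟨⟨dehomogenization Q.asHomogeneousIdeal, dehomogenization_isPrime Q.isPrime ht⟩, ?_⟩
    refine ProjectiveSpectrum.ext (HomogeneousIdeal.ext (Ideal.ext fun p => ?_))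
    refine (mem_homogenization (p := p)).trans
      (Iff.trans ?_ (mem_iff_single_mem Q.asHomogeneousIdeal p).symm)
    exact forall_congr' fun d => (single_mem_iff_mem_dehomogenization Q.isPrime ht _).symm

theorem mem_atInfinity {δ : DegreeLike K A} {Q : δ.Completion} :
    Q ∈ δ.atInfinity ↔ δ.parameter ∈ Q.asHomogeneousIdeal := by
  rw [atInfinity, range_embedding]
  exact not_not

/-! ### The prime ideal attached to a semidegree -/

/-- For a degree-like function `ε ≤ δ`, the homogeneous ideal of `A^δ` of all `∑ (f_d)_d` with
`ε f_d < d`, i.e. `ε f_d ≤ d - 1`, for all `d`. -/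
noncomputable def initialIdeal (δ ε : DegreeLike K A) (h : ∀ f, ε f ≤ δ f) :
    HomogeneousIdeal δ.gradedPiece where
  carrier := {p | ∀ d : ℕ, (p : A[X]).coeff d ∈ ε.filtration (d - 1)}
  zero_mem' d := by simp
  add_mem' {p q} hp hq d := by
    change ((p : A[X]) + (q : A[X])).coeff d ∈ _
    rw [coeff_add]
    exact add_mem (hp d) (hq d)
  smul_mem' a p hp d := by
    change ((a : A[X]) * (p : A[X])).coeff d ∈ _
    rw [coeff_mul]
    refine sum_mem fun x hx => ?_
    rw [Finset.HasAntidiagonal.mem_antidiagonal] at hx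
    have ha : (a : A[X]).coeff x.1 ∈ ε.filtration x.1 := (h _).trans (a.2 x.1)
    have := mul_mem_filtration ha (hp x.2)
    refine ε.filtration_mono (le_of_eq ?_) this
    rw [← hx]
    push_cast
    ring
  is_homogeneous' d p hp e := by
    rw [coe_decompose, coeff_monomial]
    split_ifs with hde
    · exact hde ▸ hp d
    · exact zero_mem _

section initialIdeal

variable {δ ε : DegreeLike K A} {h : ∀ f, ε f ≤ δ f}

theorem mem_initialIdeal {p : δ.gradedRing} :
    p ∈ δ.initialIdeal ε h ↔ ∀ d : ℕ, (p : A[X]).coeff d ∈ ε.filtration (d - 1) := Iff.rfl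

theorem single_mem_initialIdeal {d : ℕ} {f : A} (hf : f ∈ δ.filtration d) :
    δ.single d f hf ∈ δ.initialIdeal ε h ↔ f ∈ ε.filtration (d - 1) := by
  rw [mem_initialIdeal]
  constructor
  · intro hd
    have := hd d
    change (monomial d f).coeff d ∈ _ at this
    rwa [coeff_monomial, if_pos rfl] at this
  · intro hd e
    change (monomial d f).coeff e ∈ _
    rw [coeff_monomial]
    split_ifs with hde
    · exact hde ▸ hd
    · exact zero_mem _

theorem mem_filtration_sub_one {d : ℤ} {f : A} :
    f ∈ ε.filtration (d - 1) ↔ ε f < (d : WithBot ℤ) := by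
  rw [mem_filtration]
  cases ε f with
  | bot => simp
  | coe n =>
    norm_cast
    lia

theorem parameter_mem_initialIdeal : δ.parameter ∈ δ.initialIdeal ε h := by
  rw [parameter, single_mem_initialIdeal, mem_filtration, ε.map_one]
  exact_mod_cast le_rfl

theorem initialIdeal_isPrime (hε : ε.IsSemidegree) : (δ.initialIdeal ε h).toIdeal.IsPrime := by
  refine (δ.initialIdeal ε h).isHomogeneous.isPrime_of_homogeneous_mem_or_mem ?_ ?_
  · rw [Ideal.ne_top_iff_one]
    intro h1
    have h1' := mem_filtration_sub_one.mp (mem_initialIdeal.mp h1 0)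
    change ε ((1 : A[X]).coeff 0) < _ at h1'
    rw [coeff_one_zero, ε.map_one] at h1'
    exact lt_irrefl _ h1'
  · rintro x y ⟨d, hx⟩ ⟨e, hy⟩ hxy
    obtain ⟨f, hf, rfl⟩ := exists_eq_single_of_mem_gradedPiece hx
    obtain ⟨g, hg, rfl⟩ := exists_eq_single_of_mem_gradedPiece hy
    rw [single_mul_single, HomogeneousIdeal.mem_iff, single_mem_initialIdeal] at hxy
    rw [HomogeneousIdeal.mem_iff, HomogeneousIdeal.mem_iff, single_mem_initialIdeal,
      single_mem_initialIdeal]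
    by_cases hf0 : f = 0
    · exact Or.inl (hf0 ▸ zero_mem _)
    by_cases hg0 : g = 0
    · exact Or.inr (hg0 ▸ zero_mem _)
    rw [mem_filtration, hε f g hf0 hg0] at hxy
    rw [mem_filtration, mem_filtration]
    have hf' := (h f).trans hf
    have hg' := (h g).trans hg
    cases hef : ε f with
    | bot => simp
    | coe m =>
      cases heg : ε g with
      | bot => simp
      | coe n =>
        rw [hef, heg] at hxy
        rw [hef] at hf'
        rw [heg] at hg'
        norm_cast at hxy hf' hg' ⊢
        lia

end initialIdeal

/-! ### Presentations by semidegrees -/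

section presentation

variable {δ : DegreeLike K A} {N : ℕ} {δs : Fin N → DegreeLike K A}

theorem IsPresentation.le (hδs : δ.IsPresentation δs) (i : Fin N) (f : A) : δs i f ≤ δ f := by
  by_cases hf : f = 0
  · rw [hf, (δs i).map_zero']
    exact bot_le
  · rw [hδs.eq_max f hf]
    exact Finset.le_sup (f := fun i => δs i f) (Finset.mem_univ i)

theorem IsPresentation.exists_eq (hδs : δ.IsPresentation δs) {f : A} (hf : f ≠ 0)
    (h0 : δ f ≠ ⊥) : ∃ i, δ f = δs i f := by
  have hN : (Finset.univ : Finset (Fin N)).Nonempty := by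
    rw [Finset.nonempty_iff_ne_empty]
    intro hempty
    rw [hδs.eq_max f hf, hempty] at h0
    exact h0 rfl
  obtain ⟨i, -, hi⟩ := Finset.exists_mem_eq_sup _ hN fun i => δs i f
  exact ⟨i, (hδs.eq_max f hf).trans hi⟩

/-- A homogeneous prime at infinity contains one of the ideals attached to the semidegrees of a
presentation, because the intersection of these ideals is generated by `t`. -/
theorem exists_initialIdeal_le (hδ : δ.IsNonneg) (hδs : δ.IsPresentation δs)
    {Q : HomogeneousIdeal δ.gradedPiece} (hQ : Q.toIdeal.IsPrime) (ht : δ.parameter ∈ Q) :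
    ∃ i, δ.initialIdeal (δs i) (hδs.le i) ≤ Q := by
  have hinf : (Finset.univ.inf fun i => (δ.initialIdeal (δs i) (hδs.le i)).toIdeal) ≤
      Q.toIdeal := by
    intro p hp
    rw [Submodule.mem_finsetInf] at hp
    refine (mem_iff_single_mem Q p).mpr fun d => ?_
    have hpd : ∀ i, (p : A[X]).coeff d ∈ (δs i).filtration (d - 1) :=
      fun i => hp i (Finset.mem_univ i) d
    have hdiv : (p : A[X]).coeff d ∈ δ.filtration ((d : ℤ) - 1) := by
      generalize (p : A[X]).coeff d = f at *
      by_cases hf : f = 0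
      · exact hf ▸ zero_mem _
      · rw [mem_filtration, hδs.eq_max f hf]
        exact Finset.sup_le fun i _ => hpd i
    have hmem := p.2 d
    change δ.single d _ hmem ∈ Q
    generalize (p : A[X]).coeff d = f at *
    cases d with
    | zero =>
      -- In degree zero divisibility by `t` means vanishing, and this is where `δ ≥ 0` is needed.
      have hf : f = 0 := by
        by_contra hf
        have := mem_filtration_sub_one.mp hdiv
        exact absurd (hδ f hf) (not_le.mpr (by exact_mod_cast this))
      subst hf
      have : δ.single 0 0 hmem = 0 := Subtype.ext (map_zero _)
      rw [this]
      exact zero_mem _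
    | succ d =>
      have hd : f ∈ δ.filtration d := by simpa using hdiv
      have : δ.single (d + 1) f hmem = δ.single d f hd * δ.parameter := by
        rw [parameter, single_mul_single]
        exact single_congr _ _ _ rfl (mul_one f).symm
      rw [this]
      exact Q.toIdeal.mul_mem_left _ ht
  obtain ⟨i, -, hi⟩ := (Ideal.IsPrime.inf_le' hQ).mp hinf
  exact ⟨i, hi⟩

/-- The ideals attached to the semidegrees of a minimal presentation are pairwise incomparable: if
`δ_j` dominates strictly at `f` and `d = δ f`, then `(f)_d` lies in all of them but the `j`-th. -/
theorem IsMinimalPresentation.eq_of_initialIdeal_le (hδ : δ.IsNonneg)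
    (hδs : δ.IsMinimalPresentation δs) {i j : Fin N}
    (hij : δ.initialIdeal (δs i) (hδs.le i) ≤ δ.initialIdeal (δs j) (hδs.le j)) : i = j := by
  obtain ⟨f, hf, hmax⟩ := hδs.not_redundant j
  obtain ⟨k, hk⟩ := hδs.exists_eq hf fun h => by simpa [h] using hδ f hf
  have hkj : k = j := by
    by_contra hne
    exact absurd (hδs.le j f) (not_le.mpr (hk ▸ hmax k hne))
  subst hkj
  obtain ⟨d, hd⟩ : ∃ d : ℕ, δ f = ((d : ℤ) : WithBot ℤ) := by
    have h0 := hδ f hf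
    cases h : δ f with
    | bot => simp [h] at h0
    | coe n =>
      rw [h] at h0
      exact ⟨n.toNat, by rw [Int.toNat_of_nonneg (by exact_mod_cast h0)]⟩
  by_contra hne
  have hfd : f ∈ δ.filtration d := hd.le
  have h1 : δ.single d f hfd ∈ δ.initialIdeal (δs i) (hδs.le i) := by
    rw [single_mem_initialIdeal, mem_filtration_sub_one, ← hd, hk]
    exact hmax i hne
  have h2 := hij h1
  rw [single_mem_initialIdeal, mem_filtration_sub_one, ← hd, hk] at h2
  exact lt_irrefl _ h2

theorem pow_mem_filtration_neg {ε : DegreeLike K A} {g : A} (hg : ε g < 0) (k : ℕ) :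
    g ^ k ∈ ε.filtration (-k) := by
  have hg' : g ∈ ε.filtration (-1) := by
    have := (mem_filtration_sub_one (ε := ε) (d := 0) (f := g)).mpr (by exact_mod_cast hg)
    simpa using this
  induction k with
  | zero =>
    rw [pow_zero]
    simpa using ε.one_mem_filtration 0
  | succ k ih =>
    rw [pow_succ]
    refine ε.filtration_mono (le_of_eq ?_) (mul_mem_filtration ih hg')
    push_cast
    ring

/-- In a minimal presentation of a non-negative subdegree, a nonzero semidegree attains the value
of the subdegree at an element of positive degree. -/
theorem exists_pos_of_not_isZero [IsDomain A] (hδ : δ.IsNonneg)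
    (hδs : δ.IsMinimalPresentation δs) {i : Fin N} (hi : ¬ (δs i).IsZero) :
    ∃ h : A, δ h = δs i h ∧ 0 < δs i h := by
  -- If the maximum at `f` is not attained at an index other than `i`, it is attained at `i`.
  have hattain : ∀ f : A, f ≠ 0 → (∀ j, j ≠ i → δs j f < δ f) → δ f = δs i f := by
    intro f hf hlt
    obtain ⟨k, hk⟩ := hδs.exists_eq hf fun h => by simpa [h] using hδ f hf
    have hki : k = i := by
      by_contra hne
      exact absurd hk (hlt k hne).ne'
    rw [hk, hki]
  obtain ⟨g, hg, hmax⟩ := hδs.not_redundant i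
  have hgi : δ g = δs i g := hattain g hg fun j hj => (hmax j hj).trans_le (hδs.le i g)
  by_cases hpos : 0 < δs i g
  · exact ⟨g, hgi, hpos⟩
  have hg0 : δs i g = 0 := le_antisymm (not_lt.mp hpos) (hgi ▸ hδ g hg)
  rw [IsZero] at hi
  push Not at hi
  obtain ⟨f, hf, hfi⟩ := hi
  obtain ⟨a, ha⟩ := δ.exists_mem_filtration f
  -- Multiplying by `g` does not change the value of `δ_i` and lowers that of every other `δ_j` by
  -- at least one, so all of these are negative at `f * g ^ (a + 1)`, where `a ≥ δ f`.
  have hval : ∀ k : ℕ, δs i (f * g ^ k) = δs i f := by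
    intro k
    induction k with
    | zero => rw [pow_zero, mul_one]
    | succ k ih =>
      rw [pow_succ, ← mul_assoc,
        hδs.isSemidegree i _ _ (mul_ne_zero hf (pow_ne_zero k hg)) hg, ih, hg0, add_zero]
  have hne : f * g ^ (a + 1) ≠ 0 := mul_ne_zero hf (pow_ne_zero _ hg)
  have heq : δ (f * g ^ (a + 1)) = δs i (f * g ^ (a + 1)) := by
    refine hattain _ hne fun j hj => lt_of_lt_of_le ?_ (hδ _ hne)
    have hfj : f ∈ (δs j).filtration a := (hδs.le j f).trans ha
    have hgj := pow_mem_filtration_neg (hg0 ▸ hmax j hj) (a + 1)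
    have hprod := mul_mem_filtration hfj hgj
    refine lt_of_le_of_lt (mem_filtration.mp hprod) ?_
    norm_cast
    lia
  refine ⟨_, heq, lt_of_le_of_ne (heq ▸ hδ _ hne) ?_⟩
  rw [hval]
  exact hfi.symm

theorem irrelevant_le_initialIdeal {ε : DegreeLike K A} {h : ∀ f, ε f ≤ δ f} (hε : ε.IsZero) :
    HomogeneousIdeal.irrelevant δ.gradedPiece ≤ δ.initialIdeal ε h := by
  intro p hp d
  by_cases hc : (p : A[X]).coeff d = 0
  · rw [hc]
    exact zero_mem _
  rw [mem_filtration_sub_one, hε _ hc]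
  have hd : d ≠ 0 := by
    rintro rfl
    rw [HomogeneousIdeal.mem_irrelevant_iff, GradedRing.proj_apply] at hp
    have := congrArg (fun q : δ.gradedRing => (q : A[X]).coeff 0) hp
    rw [coe_decompose, coeff_monomial, if_pos rfl] at this
    exact hc this
  exact_mod_cast Nat.pos_of_ne_zero hd

/-- The point of `X_∞` given by the ideal of a nonzero semidegree of a minimal presentation. -/
noncomputable def pointAtInfinity [IsDomain A] (hδ : δ.IsNonneg)
    (hδs : δ.IsMinimalPresentation δs) (i : {i : Fin N // ¬ (δs i).IsZero}) : δ.atInfinity :=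
  ⟨{ asHomogeneousIdeal := δ.initialIdeal (δs i) (hδs.le i)
     isPrime := initialIdeal_isPrime (hδs.isSemidegree i)
     not_irrelevant_le := by
      intro hle
      obtain ⟨h, hh, hpos⟩ := exists_pos_of_not_isZero hδ hδs i.2
      obtain ⟨d, hd0, hd⟩ : ∃ d : ℕ, 0 < d ∧ δs i h = ((d : ℤ) : WithBot ℤ) := by
        cases hn : δs i h with
        | bot => simp [hn] at hpos
        | coe n =>
          rw [hn] at hpos
          norm_cast at hpos
          exact ⟨n.toNat, by lia, by rw [Int.toNat_of_nonneg hpos.le]⟩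
      have hmem : h ∈ δ.filtration d := (hh.trans hd).le
      have h1 := hle (HomogeneousIdeal.mem_irrelevant_of_mem _ hd0 (δ.single_mem_gradedPiece hmem))
      rw [single_mem_initialIdeal, mem_filtration_sub_one, hd] at h1
      exact lt_irrefl _ h1 },
   mem_atInfinity.mpr (parameter_mem_initialIdeal (h := hδs.le i))⟩

theorem specializes_iff_asHomogeneousIdeal_le {x y : δ.atInfinity} :
    x ⤳ y ↔ x.1.asHomogeneousIdeal ≤ y.1.asHomogeneousIdeal := by
  rw [subtype_specializes_iff, specializes_iff_mem_closure,
    ← ProjectiveSpectrum.le_iff_mem_closure, ProjectiveSpectrum.as_ideal_le_as_ideal]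

theorem encard_irreducibleComponents_atInfinity [IsDomain A] (hδ : δ.IsNonneg)
    (hδs : δ.IsMinimalPresentation δs) :
    (irreducibleComponents δ.atInfinity).encard = ENat.card {i : Fin N // ¬ (δs i).IsZero} := by
  refine encard_irreducibleComponents_of_specializes (pointAtInfinity hδ hδs) ?_ ?_
  · intro y
    obtain ⟨i, hi⟩ := exists_initialIdeal_le hδ hδs.toIsPresentation y.1.isPrime
      (mem_atInfinity.mp y.2)
    have hi0 : ¬ (δs i).IsZero := fun h0 =>
      y.1.not_irrelevant_le ((irrelevant_le_initialIdeal h0).trans hi)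
    exact ⟨⟨i, hi0⟩, specializes_iff_asHomogeneousIdeal_le.mpr hi⟩
  · intro i j hij
    exact Subtype.ext
      (hδs.eq_of_initialIdeal_le hδ (specializes_iff_asHomogeneousIdeal_le.mp hij))

theorem IsMinimalPresentation.eq_of_isZero (hδs : δ.IsMinimalPresentation δs) {i j : Fin N}
    (hi : (δs i).IsZero) (hj : (δs j).IsZero) : i = j := by
  by_contra hne
  obtain ⟨f, hf, hmax⟩ := hδs.not_redundant j
  have := hmax i hne
  rw [hi f hf, hj f hf] at this
  exact lt_irrefl _ this

end presentation

end DegreeLike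

theorem corollary4p3 {K A : Type*} [Field K] [CommRing A] [IsDomain A] [Algebra K A]
    (δ : DegreeLike K A) (hδ : δ.IsNonneg) {N : ℕ} (δs : Fin N → DegreeLike K A)
    (hδs : δ.IsMinimalPresentation δs) :
    ((∀ i, ¬ (δs i).IsZero) → (irreducibleComponents δ.atInfinity).encard = N) ∧
    ((∃ i, (δs i).IsZero) → (irreducibleComponents δ.atInfinity).encard + 1 = N) := by
  rw [DegreeLike.encard_irreducibleComponents_atInfinity hδ hδs,
    show ENat.card {i : Fin N // ¬ (δs i).IsZero} = {i | ¬ (δs i).IsZero}.encard from rfl]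
  have huniv : (Set.univ : Set (Fin N)).encard = N := by simp
  constructor
  · intro hnone
    rw [Set.eq_univ_of_forall (s := {i | ¬ (δs i).IsZero}) hnone, huniv]
  · rintro ⟨i, hi⟩
    have hset : {i | ¬ (δs i).IsZero} = Set.univ \ {i} := by
      ext j
      simp only [Set.mem_ofPred_eq, Set.mem_sdiff, Set.mem_univ, Set.mem_singleton_iff, true_and]
      exact not_congr ⟨fun hj => hδs.eq_of_isZero hj hi, fun hj => hj ▸ hi⟩
    rw [hset, Set.encard_sdiff_singleton_add_one (Set.mem_univ i), huniv]
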